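/- A lattice polytope $P\subset\mathbb R^n$ is the convex hull of a nonempty finite subset of $\mathbb Z^n$; it is a $d$-polytope if its affine span $\operatorname{aff}P$ has dimension $d$. Let $V$ be the linear space parallel to $\operatorname{aff}P$, let $M=\mathbb Z^n\cap V$, and let $M^\vee\subset V^*$ be the lattice of linear functionals on $V$ taking integral values on $M$. The normal fan of $P$ consists of the cones $\{\varphi\in V^* : \varphi(y-x)\ge 0 \text{ for all } x\in F,\ y\in P\}$, where $F$ runs over the nonempty faces of $P$ (including $P$ itself). A cone in $V^*$ is unimodular if it is generated by a (possibly empty) subset of a $\mathbb Z$-basis of $M^\vee$, and $P$ is smooth if every cone in its normal fan is unimodular. Two lattice polytopes $P\subset\mathbb R^n$ and $P'\subset\mathbb R^{n'}$ are integrally equivalent if there is an affine map $\operatorname{aff}P\to\operatorname{aff}P'$ that maps $\mathbb Z^n\cap\operatorname{aff}P$ bijectively to $\mathbb Z^{n'}\cap\operatorname{aff}P'$ and $P$ onto $P'$. Let $d$ and $k$ be nonnegative integers. Then, among all smooth lattice $d$-polytopes $P\subset\mathbb R^n$ (for arbitrary $n$) with exactly $k$ lattice points, i.e. $|P\cap\mathbb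 Z^n|=k$, there are only finitely many integral equivalence classes. -/

import Mathlib

namespace SmoothPolytope

/-- The integer lattice `ℤⁿ` inside `ℝⁿ`. -/
def intLattice (n : ℕ) : Submodule ℤ (Fin n → ℝ) where
  carrier := {x | ∀ i, ∃ k : ℤ, x i = k}
  add_mem' := by
    intro a b ha hb i
    obtain ⟨k, hk⟩ := ha i
    obtain ⟨l, hl⟩ := hb i
    exact ⟨k + l, by simp [hk, hl]⟩
  zero_mem' := fun i => ⟨0, by simp⟩
  smul_mem' := by
    intro c x hx i
    obtain ⟨k, hk⟩ := hx i
    exact ⟨c * k, by simp [hk]⟩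

/-- A (nonempty) lattice polytope in `ℝⁿ`: the convex hull of a nonempty finite set of points
of `ℤⁿ`. -/
def IsLatticePolytope {n : ℕ} (P : Set (Fin n → ℝ)) : Prop :=
  ∃ S : Finset (Fin n → ℝ), S.Nonempty ∧ (∀ x ∈ S, x ∈ intLattice n) ∧
    P = convexHull ℝ (S : Set (Fin n → ℝ))

/-- The lattice `N = Hom(M, ℤ)`, where `M = ℤⁿ ∩ V` and `V = vectorSpan ℝ P` is the linear space
parallel to the affine span of `P`, realised as the linear functionals on `V` that take
integral values on `M`. (If `P` has full dimension then `V = ℝⁿ` and `M = ℤⁿ`.) -/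
def dualLattice {n : ℕ} (P : Set (Fin n → ℝ)) :
    Submodule ℤ (Module.Dual ℝ (vectorSpan ℝ P)) where
  carrier := {φ | ∀ v : vectorSpan ℝ P, (v : Fin n → ℝ) ∈ intLattice n → ∃ k : ℤ, φ v = k}
  add_mem' := by
    intro a b ha hb v hv
    obtain ⟨k, hk⟩ := ha v hv
    obtain ⟨l, hl⟩ := hb v hv
    exact ⟨k + l, by simp [hk, hl]⟩
  zero_mem' := fun v _ => ⟨0, by simp⟩
  smul_mem' := by
    intro c φ hφ v hv
    obtain ⟨k, hk⟩ := hφ v hv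
    exact ⟨c * k, by simp [hk]⟩

/-- The tangent cone `cone (y - x : x ∈ F, y ∈ P)` of `P` along `F`, as a cone in the linear space
parallel to the affine span of `P`. -/
def tangentCone {n : ℕ} (P F : Set (Fin n → ℝ)) : PointedCone ℝ (vectorSpan ℝ P) :=
  PointedCone.hull ℝ {v | ∃ x ∈ F, ∃ y ∈ P, (v : Fin n → ℝ) = y - x}

/-- The (inner) normal cone of `P` at `F`: the dual of the tangent cone. -/
def normalCone {n : ℕ} (P F : Set (Fin n → ℝ)) :
    PointedCone ℝ (Module.Dual ℝ (vectorSpan ℝ P)) :=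
  PointedCone.dual (Module.Dual.eval ℝ (vectorSpan ℝ P)) (tangentCone P F)

/-- The normal fan of `P`: the normal cones at the nonempty faces of `P`, including `P` itself.
(Faces of a polytope are its exposed subsets.) -/
def normalFan {n : ℕ} (P : Set (Fin n → ℝ)) :
    Set (PointedCone ℝ (Module.Dual ℝ (vectorSpan ℝ P))) :=
  {σ | ∃ F : Set (Fin n → ℝ), F.Nonempty ∧ IsExposed ℝ P F ∧ σ = normalCone P F}

/-- A cone `σ` in a real vector space `W` is unimodular with respect to a lattice `L` in `W` if it
is generated by part of a `ℤ`-basis of `L`. -/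
def IsUnimodular {W : Type*} [AddCommGroup W] [Module ℝ W] (L : Submodule ℤ W)
    (σ : PointedCone ℝ W) : Prop :=
  ∃ (m : ℕ) (b : Module.Basis (Fin m) ℤ L) (s : Set (Fin m)),
    σ = PointedCone.hull ℝ ((fun i => (b i : W)) '' s)

/-- Every cone of the normal fan is unimodular. -/
def IsSmooth {n : ℕ} (P : Set (Fin n → ℝ)) : Prop :=
  ∀ σ ∈ normalFan P, IsUnimodular (dualLattice P) σ

/-- Integral equivalence: an affine map sends `ℤⁿ ∩ aff P` bijectively onto `ℤⁿ' ∩ aff P'` and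
sends `P` onto `P'`. (An affine map between the affine spans is the same as the
restriction to `aff P` of an affine map of the ambient spaces sending `P` onto `P'`.) -/
def IntegrallyEquivalent {n n' : ℕ} (P : Set (Fin n → ℝ)) (P' : Set (Fin n' → ℝ)) : Prop :=
  ∃ f : (Fin n → ℝ) →ᵃ[ℝ] (Fin n' → ℝ),
    Set.BijOn f {x | x ∈ intLattice n ∧ x ∈ affineSpan ℝ P}
      {x | x ∈ intLattice n' ∧ x ∈ affineSpan ℝ P'} ∧
    f '' P = P'

theorem IntegrallyEquivalent.refl {n : ℕ} (P : Set (Fin n → ℝ)) : IntegrallyEquivalent P P :=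
  ⟨AffineMap.id ℝ _, by simpa using Set.bijOn_id _, by simp⟩

theorem IntegrallyEquivalent.trans {n₁ n₂ n₃ : ℕ} {P₁ : Set (Fin n₁ → ℝ)}
    {P₂ : Set (Fin n₂ → ℝ)} {P₃ : Set (Fin n₃ → ℝ)} (h : IntegrallyEquivalent P₁ P₂)
    (h' : IntegrallyEquivalent P₂ P₃) : IntegrallyEquivalent P₁ P₃ := by
  obtain ⟨f, hf, rfl⟩ := h
  obtain ⟨g, hg, rfl⟩ := h'
  exact ⟨g.comp f, by simpa using hg.comp hf, by simp [Set.image_comp]⟩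

theorem IntegrallyEquivalent.symm {n n' : ℕ} {P : Set (Fin n → ℝ)} {P' : Set (Fin n' → ℝ)}
    (hP : P.Nonempty)
    (hd : Module.finrank ℝ (vectorSpan ℝ P) = Module.finrank ℝ (vectorSpan ℝ P'))
    (h : IntegrallyEquivalent P P') : IntegrallyEquivalent P' P := by
  obtain ⟨f, hf, rfl⟩ := h
  obtain ⟨p, hp⟩ := hP
  have hmap : (vectorSpan ℝ P).map f.linear = vectorSpan ℝ (f '' P) :=
    AffineMap.map_vectorSpan f
  have hinj : Function.Injective (f.linear.domRestrict (vectorSpan ℝ P)) := by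
    rw [← LinearMap.ker_eq_bot, ← Submodule.finrank_eq_zero (R := ℝ)]
    have h1 := LinearMap.finrank_range_add_finrank_ker
      (f.linear.domRestrict (vectorSpan ℝ P))
    rw [LinearMap.range_domRestrict, hmap, ← hd] at h1
    omega
  obtain ⟨g, hg⟩ := LinearMap.exists_leftInverse_of_injective _ (LinearMap.ker_eq_bot.2 hinj)
  let g' : (Fin n' → ℝ) →ₗ[ℝ] (Fin n → ℝ) := (vectorSpan ℝ P).subtype ∘ₗ g
  let G : (Fin n' → ℝ) →ᵃ[ℝ] (Fin n → ℝ) :=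
    g'.toAffineMap.comp (AffineMap.id ℝ _ - AffineMap.const ℝ _ (f p)) + AffineMap.const ℝ _ p
  have hG : ∀ x ∈ affineSpan ℝ P, G (f x) = x := by
    intro x hx
    have hv : x - p ∈ vectorSpan ℝ P := by
      rw [← direction_affineSpan]
      exact AffineSubspace.vsub_mem_direction hx (subset_affineSpan ℝ P hp)
    have h2 : g (f.linear (x - p)) = ⟨x - p, hv⟩ :=
      LinearMap.congr_fun hg ⟨x - p, hv⟩
    have h3 : f x - f p = f.linear (x - p) := (f.linearMap_vsub x p).symm
    have h4 : G (f x) = g' (f x - f p) + p := by simp [G]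
    rw [h4, h3]
    simp only [g', LinearMap.comp_apply, h2, Submodule.subtype_apply, sub_add_cancel]
  refine ⟨G, ?_, ?_⟩
  · refine Set.BijOn.symm (f := f) ⟨?_, ?_⟩ hf
    · intro y hy
      obtain ⟨x, hx, rfl⟩ := hf.surjOn hy
      rw [hG x hx.2]
    · intro x hx
      exact hG x hx.2
  · rw [Set.image_image]
    calc (fun x => G (f x)) '' P = id '' P :=
          Set.image_congr fun x hx => hG x (subset_affineSpan ℝ P hx)
      _ = P := Set.image_id P

/-- Smooth lattice polytopes of dimension `d`, in some `ℝⁿ`, with exactly `k` lattice points. -/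
structure SmoothLatticePolytope (d k : ℕ) where
  /-- the dimension of the ambient space -/
  ambientDim : ℕ
  /-- the polytope as a set of points -/
  carrier : Set (Fin ambientDim → ℝ)
  isLatticePolytope : IsLatticePolytope carrier
  finrank_eq : Module.finrank ℝ (vectorSpan ℝ carrier) = d
  isSmooth : IsSmooth carrier
  encard_eq : {x | x ∈ carrier ∧ x ∈ intLattice ambientDim}.encard = k

/-- Integral equivalence as an equivalence relation on smooth lattice `d`-polytopes with `k`
lattice points. -/
def integralEquivalence (d k : ℕ) : Setoid (SmoothLatticePolytope d k) where
  r P Q := IntegrallyEquivalent P.carrier Q.carrier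
  iseqv :=
    { refl := fun P => IntegrallyEquivalent.refl P.carrier
      symm := by
        intro P Q h
        refine h.symm ?_ (P.finrank_eq.trans Q.finrank_eq.symm)
        obtain ⟨S, hS, -, hP⟩ := P.isLatticePolytope
        rw [hP]
        exact hS.to_set.convexHull
      trans := fun h h' => h.trans h' }

end SmoothPolytope

/-!
A smooth lattice polytope with set of lattice points `A` has at every vertex `v` an edge basis: a
`ℤ`-basis of the lattice consisting of the primitive vectors along the edges at `v`. It is dual to
the basis of functionals generating the normal cone at `v`, and in the coordinates that it defines
the polytope lies in the nonnegative orthant.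

Passing from `v` to the other end of its edge in direction `b i` turns the edge basis `b` into
vectors of the form `b m + c • b i` together with a negative multiple of `b i`. A lattice segment in
the polytope has at most `#A` points, so `c < #A`. Hence, if a functional `φ` is at most `C` on `b`
and `φ (b i) > 0`, then `φ` is at most `#A * C` on the new edge basis. Following edges along which
the `i`-th coordinate at `v` increases, one reaches its maximum over the polytope in at most `#A`
steps, so this maximum is less than `#A ^ #A`. The polytope is therefore integrally equivalent to
the convex hull of some of the finitely many lattice points of a box that depends only on its
dimension and on `#A`.
-/

namespace SmoothPolytope

open Finset Filter

section LatticeConvex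

variable {E : Type*} [AddCommGroup E] [Module ℝ E] {L : Submodule ℤ E} {A : Finset E} {v : E}

/-- A finite set consisting of all points of the lattice `L` in its convex hull. It models the set
of lattice points of a lattice polytope. -/
def IsLatticeConvex (L : Submodule ℤ E) (A : Finset E) : Prop :=
  ∀ x, x ∈ A ↔ x ∈ convexHull ℝ (A : Set E) ∧ x ∈ L

/-- `v` is a vertex of the convex hull of the finite set `A`, encoded by a linear functional whose
minimum over `A` is attained at `v` only. -/
def IsVertex (A : Finset E) (v : E) : Prop :=
  v ∈ A ∧ ∃ φ : Module.Dual ℝ E, ∀ a ∈ A, a ≠ v → φ v < φ a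

theorem IsLatticeConvex.mem_lattice (hA : IsLatticeConvex L A) {a : E} (ha : a ∈ A) : a ∈ L :=
  ((hA a).1 ha).2

theorem IsLatticeConvex.add_nsmul_mem (hA : IsLatticeConvex L A) {p u : E} {m n : ℕ}
    (hp : p ∈ A) (hq : p + n • u ∈ A) (hu : u ∈ L) (hmn : m ≤ n) : p + m • u ∈ A := by
  rcases n.eq_zero_or_pos with rfl | hn
  · rwa [Nat.le_zero.1 hmn]
  refine (hA _).2 ⟨?_, add_mem (hA.mem_lattice hp) (nsmul_mem hu m)⟩
  have hratio : (m / n : ℝ) ∈ Set.Icc (0 : ℝ) 1 :=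
    ⟨by positivity, div_le_one_of_le₀ (by exact_mod_cast hmn) n.cast_nonneg⟩
  have hmem := (convex_convexHull ℝ (A : Set E)).add_smul_sub_mem ((hA _).1 hp).1 ((hA _).1 hq).1
    hratio
  rwa [add_sub_cancel_left, ← Nat.cast_smul_eq_nsmul ℝ n, smul_smul,
    div_mul_cancel₀ _ (by positivity), Nat.cast_smul_eq_nsmul] at hmem

theorem IsLatticeConvex.lt_card (hA : IsLatticeConvex L A) {p u : E} {n : ℕ}
    (hp : p ∈ A) (hq : p + n • u ∈ A) (hu : u ∈ L) (hu₀ : u ≠ 0) : n < #A := by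
  classical
  have hinj : Function.Injective fun m : ℕ => p + m • u :=
    (add_right_injective p).comp fun m m' h => by
      simp only [← Nat.cast_smul_eq_nsmul ℝ] at h
      exact Nat.cast_injective (smul_left_injective ℝ hu₀ h)
  have hsub : (range (n + 1)).image (fun m : ℕ => p + m • u) ⊆ A :=
    image_subset_iff.2 fun m hm => hA.add_nsmul_mem hp hq hu (by simpa [Nat.lt_succ_iff] using hm)
  simpa [card_image_of_injective _ hinj, Nat.succ_le_iff] using card_le_card hsub

theorem exists_isVertex (hA : A.Nonempty) : ∃ v, IsVertex A v := by
  obtain ⟨φ, hφ⟩ := Module.exists_dual_forall_apply_ne_zero (K := ℝ)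
    (fun p : {p : A × A // p.1 ≠ p.2} => (p.1.1 - p.1.2 : E))
    fun p => sub_ne_zero.2 fun h => p.2 (Subtype.ext h)
  obtain ⟨v, hv, hmin⟩ := exists_min_image A φ hA
  refine ⟨v, hv, φ, fun a ha hav => (hmin a ha).lt_of_ne fun h => ?_⟩
  refine hφ ⟨(⟨a, ha⟩, ⟨v, hv⟩), fun h => hav (congrArg Subtype.val h)⟩ ?_
  rw [map_sub, h, sub_self]

theorem IsVertex.exists_forall_mem_convexHull_lt (hv : IsVertex A v) :
    ∃ φ : Module.Dual ℝ E, ∀ x ∈ convexHull ℝ (A : Set E), x ≠ v → φ v < φ x := by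
  classical
  obtain ⟨hvA, φ, hφ⟩ := hv
  refine ⟨φ, fun x hx hxv => ?_⟩
  rcases (A.erase v).eq_empty_or_nonempty with hA | hA
  · have hAv : A = {v} := by rw [← insert_erase hvA, hA, insert_empty]
    simp [hAv, hxv] at hx
  rw [← insert_erase hvA, coe_insert, convexHull_insert (by exact_mod_cast hA),
    mem_convexJoin] at hx
  obtain ⟨w, hw, y, hy, s, t, -, ht, hst, rfl⟩ := hx
  obtain rfl := Set.mem_singleton_iff.1 hw
  have hlt : φ w < φ y :=
    convexHull_min (fun a ha => by
      have ha' := mem_erase.1 (mem_coe.1 ha)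
      exact hφ a ha'.2 ha'.1) (convex_halfSpace_gt φ.isLinear (φ w)) hy
  obtain rfl : s = 1 - t := eq_sub_of_add_eq hst
  have ht₀ : t ≠ 0 := by
    rintro rfl
    simp at hxv
  have := mul_pos (ht.lt_of_ne' ht₀) (sub_pos.2 hlt)
  rw [map_add, map_smul, map_smul, smul_eq_mul, smul_eq_mul]
  linarith

theorem eventually_forall_pos_add_mul {α : Type*} (s : Finset α) (f g : α → ℝ) :
    ∀ᶠ K in atTop, ∀ a ∈ s, 0 < f a → 0 < g a + K * f a := by
  refine (eventually_all_finset s).2 fun a _ => eventually_imp_distrib_left.2 fun ha => ?_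
  exact (tendsto_atTop_add_const_left _ _ (tendsto_id.atTop_mul_const ha)).eventually_gt_atTop 0

end LatticeConvex

section EdgeBasis

variable {E ι : Type*} [AddCommGroup E] [Module ℝ E] {L : Submodule ℤ E} {A : Finset E} {v x : E}
  {b b' : Module.Basis ι ℝ E} {i j : ι} {l : ℕ}

theorem apply_eq_sum_repr_mul (b : Module.Basis ι ℝ E) (φ : Module.Dual ℝ E) (x : E) :
    φ x = ∑ i ∈ (b.repr x).support, b.repr x i * φ (b i) := by
  conv_lhs => rw [← b.linearCombination_repr x]
  simp only [Finsupp.linearCombination_apply, Finsupp.sum, map_sum, map_smul, smul_eq_mul]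

/-- The sum of the coordinates other than the `i`-th one with respect to `b`. On the cone generated
by `b`, it vanishes exactly on the ray of `b i`. -/
noncomputable def offEdge (b : Module.Basis ι ℝ E) (i : ι) : Module.Dual ℝ E :=
  b.constr ℝ (Set.indicator {i}ᶜ 1)

theorem offEdge_self (b : Module.Basis ι ℝ E) (i : ι) : offEdge b i (b i) = 0 := by
  simp [offEdge]

theorem offEdge_of_ne (b : Module.Basis ι ℝ E) (hj : j ≠ i) : offEdge b i (b j) = 1 := by
  simp [offEdge, hj]

theorem repr_mul_offEdge_nonneg (hx : ∀ j ≠ i, 0 ≤ b.repr x j) (j : ι) :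
    0 ≤ b.repr x j * offEdge b i (b j) := by
  rcases eq_or_ne j i with rfl | hj
  · rw [offEdge_self, mul_zero]
  · rw [offEdge_of_ne b hj, mul_one]
    exact hx j hj

theorem offEdge_nonneg (hx : ∀ j ≠ i, 0 ≤ b.repr x j) : 0 ≤ offEdge b i x := by
  rw [apply_eq_sum_repr_mul b]
  exact sum_nonneg fun j _ => repr_mul_offEdge_nonneg hx j

theorem eq_smul_of_offEdge_nonpos (hx : ∀ j ≠ i, 0 ≤ b.repr x j) (h : offEdge b i x ≤ 0) :
    x = b.repr x i • b i := by
  have hsum := le_antisymm h (offEdge_nonneg hx)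
  rw [apply_eq_sum_repr_mul b,
    sum_eq_zero_iff_of_nonneg fun j _ => repr_mul_offEdge_nonneg hx j] at hsum
  refine b.ext_elem fun j => ?_
  rcases eq_or_ne j i with rfl | hj
  · simp
  · have hzero : b.repr x j = 0 := by simpa [offEdge_of_ne b hj] using hsum j
    simp [hzero, hj]

/-- `b` is the basis formed by the primitive vectors along the edges of the smooth polytope
`convexHull ℝ A` at its vertex `v`. -/
structure IsEdgeBasis (L : Submodule ℤ E) (A : Finset E) (v : E) (b : Module.Basis ι ℝ E) :
    Prop where
  span_range : Submodule.span ℤ (Set.range b) = L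
  mem : v ∈ A
  repr_nonneg : ∀ a ∈ A, ∀ i, 0 ≤ b.repr (a - v) i
  add_mem : ∀ i, v + b i ∈ A

namespace IsEdgeBasis

theorem basis_mem (h : IsEdgeBasis L A v b) (i : ι) : b i ∈ L :=
  h.span_range ▸ Submodule.subset_span (Set.mem_range_self i)

theorem exists_repr_eq_intCast (h : IsEdgeBasis L A v b) (hx : x ∈ L) (i : ι) :
    ∃ c : ℤ, b.repr x i = c := by
  rw [← h.span_range, b.mem_span_iff_repr_mem ℤ] at hx
  obtain ⟨c, hc⟩ := hx i
  exact ⟨c, hc.symm⟩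

theorem exists_neighbour (hA : IsLatticeConvex L A) (h : IsEdgeBasis L A v b) (i : ι) :
    ∃ l : ℕ, 0 < l ∧ IsVertex A (v + l • b i) := by
  classical
  have hlt {m : ℕ} (hm : v + m • b i ∈ A) : m < #A :=
    hA.lt_card h.mem hm (h.basis_mem i) (b.ne_zero i)
  have hone : v + 1 • b i ∈ A := by simpa using h.add_mem i
  set l := Nat.findGreatest (fun m => v + m • b i ∈ A) #A
  have hmax {m : ℕ} (hm : v + m • b i ∈ A) : m ≤ l := Nat.le_findGreatest (hlt hm).le hm
  obtain ⟨K, hK⟩ := (eventually_forall_pos_add_mul A (fun a => offEdge b i (a - (v + l • b i)))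
    fun a => -b.coord i (a - (v + l • b i))).exists
  refine ⟨l, hmax hone, Nat.findGreatest_spec (P := fun m => v + m • b i ∈ A) (hlt hone).le hone,
    -b.coord i + K • offEdge b i, fun a ha hav => ?_⟩
  rw [← sub_pos, ← map_sub]
  rcases lt_or_ge 0 (offEdge b i (a - (v + l • b i))) with hpos | hle
  · exact hK a ha hpos
  have hrepr (j : ι) := h.repr_nonneg a ha j
  have hay : a - v = b.repr (a - v) i • b i := by
    refine eq_smul_of_offEdge_nonpos (fun j _ => hrepr j) ?_
    rwa [← sub_sub, map_sub, map_nsmul, offEdge_self, smul_zero, sub_zero] at hle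
  obtain ⟨c, hc⟩ := h.exists_repr_eq_intCast (sub_mem (hA.mem_lattice ha) (hA.mem_lattice h.mem)) i
  have hc₀ := hrepr i
  rw [hc] at hay hc₀
  lift c to ℕ using by exact_mod_cast hc₀
  obtain rfl : a = v + c • b i := by
    rw [← sub_eq_iff_eq_add', hay, Int.cast_natCast, Nat.cast_smul_eq_nsmul]
  have hcl : c < l := (hmax ha).lt_of_ne (by rintro rfl; exact hav rfl)
  simpa [offEdge_self] using hcl

section Neighbour

variable (h : IsEdgeBasis L A v b) (h' : IsEdgeBasis L A (v + l • b i) b')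
include h h'

theorem neighbour_repr_nonneg (m : ι) (hj : j ≠ i) : 0 ≤ b.repr (b' m) j := by
  simpa [add_assoc, hj] using h.repr_nonneg _ (h'.add_mem m) j

theorem neighbour_offEdge_nonneg (m : ι) : 0 ≤ offEdge b i (b' m) :=
  offEdge_nonneg fun _ => neighbour_repr_nonneg h h' m

theorem neighbour_repr_edge_nonpos (hl : 0 < l) (j : ι) : b'.repr (b i) j ≤ 0 := by
  have := h'.repr_nonneg v h.mem j
  simp only [sub_add_cancel_left, map_neg, map_nsmul, Finsupp.neg_apply, Finsupp.smul_apply,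
    nsmul_eq_mul, Left.nonneg_neg_iff] at this
  exact nonpos_of_mul_nonpos_right this (by exact_mod_cast hl)

theorem neighbour_repr_edge_mul_offEdge (hl : 0 < l) (j : ι) :
    b'.repr (b i) j * offEdge b i (b' j) = 0 := by
  have hsum := apply_eq_sum_repr_mul b' (offEdge b i) (b i)
  rw [offEdge_self, eq_comm, sum_eq_zero_iff_of_nonpos fun m _ => mul_nonpos_of_nonpos_of_nonneg
    (neighbour_repr_edge_nonpos h h' hl m) (neighbour_offEdge_nonneg h h' m)] at hsum
  by_cases hj : b'.repr (b i) j = 0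
  · rw [hj, zero_mul]
  · exact hsum j (Finsupp.mem_support_iff.2 hj)

theorem neighbour_eq_smul_of_repr_edge_ne_zero (hl : 0 < l) (hj : b'.repr (b i) j ≠ 0) :
    ∃ t : ℝ, t < 0 ∧ b' j = t • b i := by
  have hoff := (mul_eq_zero.1 (neighbour_repr_edge_mul_offEdge h h' hl j)).resolve_left hj
  have hb := eq_smul_of_offEdge_nonpos (fun _ => neighbour_repr_nonneg h h' j) hoff.le
  have hone : b.repr (b' j) i * b'.repr (b i) j = 1 := by
    simpa using (congrArg (fun y => b'.repr y j) hb).symm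
  refine ⟨_, ?_, hb⟩
  exact (neg_iff_neg_of_mul_pos (hone ▸ one_pos)).2
    ((neighbour_repr_edge_nonpos h h' hl j).lt_of_ne hj)

/-- Expanding `b' j` in the basis `b` and then back in `b'` gives `1` as a sum of products of
nonnegative integers. -/
theorem exists_neighbour_one_le_repr (hj : b'.repr (b i) j = 0) :
    ∃ m ≠ i, 1 ≤ b.repr (b' j) m ∧ 1 ≤ b'.repr (b m) j := by
  have hsum : ∑ _m ∈ (b.repr (b' j)).support, (0 : ℝ) <
      ∑ m ∈ (b.repr (b' j)).support, b.repr (b' j) m * b'.repr (b m) j := by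
    have := apply_eq_sum_repr_mul b (b'.coord j) (b' j)
    simp only [b'.coord_apply, b'.repr_self, Finsupp.single_eq_same] at this
    simp [← this]
  obtain ⟨m, -, hm⟩ := exists_lt_of_sum_lt hsum
  have hmi : m ≠ i := by
    rintro rfl
    simp [hj] at hm
  have hpos : 0 < b.repr (b' j) m :=
    pos_of_mul_pos_left hm (by simpa [hj] using h'.repr_nonneg _ (h.add_mem m) j)
  have hpos' := (pos_iff_pos_of_mul_pos hm).1 hpos
  obtain ⟨c, hc⟩ := h.exists_repr_eq_intCast (h'.basis_mem j) m
  obtain ⟨c', hc'⟩ := h'.exists_repr_eq_intCast (h.basis_mem m) j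
  rw [hc] at hpos
  rw [hc'] at hpos'
  refine ⟨m, hmi, ?_, ?_⟩
  · rw [hc]; exact_mod_cast hpos
  · rw [hc']; exact_mod_cast hpos'

theorem neighbour_offEdge_le_one (hl : 0 < l) {m : ι} (hm : m ≠ i) (hmj : 1 ≤ b'.repr (b m) j) :
    offEdge b i (b' j) ≤ 1 := by
  have hnonneg (n : ι) : 0 ≤ b'.repr (b m) n * offEdge b i (b' n) := by
    have := mul_nonneg (h'.repr_nonneg _ (h.add_mem m) n) (neighbour_offEdge_nonneg h h' n)
    have hzero := neighbour_repr_edge_mul_offEdge h h' hl n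
    simpa [sub_mul, mul_assoc, hzero] using this
  calc offEdge b i (b' j) ≤ b'.repr (b m) j * offEdge b i (b' j) :=
        le_mul_of_one_le_left (neighbour_offEdge_nonneg h h' j) hmj
    _ ≤ ∑ n ∈ (b'.repr (b m)).support, b'.repr (b m) n * offEdge b i (b' n) :=
        single_le_sum (fun n _ => hnonneg n)
          (Finsupp.mem_support_iff.2 (one_pos.trans_le hmj).ne')
    _ = offEdge b i (b m) := (apply_eq_sum_repr_mul b' _ _).symm
    _ = 1 := offEdge_of_ne b hm

theorem neighbour_eq_add_smul_of_repr_edge_eq_zero (hl : 0 < l)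
    (hj : b'.repr (b i) j = 0) : ∃ m ≠ i, ∃ c : ℤ, b' j = b m + c • b i := by
  obtain ⟨m, hmi, hm, hm'⟩ := exists_neighbour_one_le_repr h h' hj
  obtain ⟨c, hc⟩ := h.exists_repr_eq_intCast (sub_mem (h'.basis_mem j) (h.basis_mem m)) i
  refine ⟨m, hmi, c, ?_⟩
  rw [← sub_eq_iff_eq_add', ← Int.cast_smul_eq_zsmul ℝ, ← hc]
  refine eq_smul_of_offEdge_nonpos (fun n hn => ?_) ?_
  · rw [map_sub, Finsupp.sub_apply, b.repr_self, sub_nonneg]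
    rcases eq_or_ne n m with rfl | hnm
    · rwa [Finsupp.single_eq_same]
    · rw [Finsupp.single_eq_of_ne hnm]
      exact neighbour_repr_nonneg h h' j hn
  · rw [map_sub, offEdge_of_ne b hmi, sub_nonpos]
    exact neighbour_offEdge_le_one h h' hl hmi hm'

theorem lt_card_of_neighbour_eq (hA : IsLatticeConvex L A) {m : ι} {c : ℤ}
    (hc : b' j = b m + c • b i) : c < #A := by
  rcases lt_or_ge c 0 with hneg | hnonneg
  · omega
  lift c to ℕ using hnonneg
  have hmem : v + b m + (c + l) • b i ∈ A := by
    convert h'.add_mem j using 1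
    rw [hc, natCast_zsmul, add_nsmul]
    abel
  have := hA.lt_card (h.add_mem m) hmem (h.basis_mem i) (b.ne_zero i)
  omega

theorem apply_neighbour_le (hA : IsLatticeConvex L A) (hl : 0 < l) {φ : Module.Dual ℝ E} {C : ℝ}
    (hφ : ∀ m, φ (b m) ≤ C) (hφi : 0 < φ (b i)) (j : ι) : φ (b' j) ≤ #A * C := by
  have hC : 0 ≤ C := hφi.le.trans (hφ i)
  by_cases hj : b'.repr (b i) j = 0
  · obtain ⟨m, -, c, hc⟩ := neighbour_eq_add_smul_of_repr_edge_eq_zero h h' hl hj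
    have hcard : (c : ℝ) ≤ #A - 1 := by
      exact_mod_cast Int.le_sub_one_of_lt (lt_card_of_neighbour_eq h h' hA hc)
    have hA₁ : (1 : ℝ) ≤ #A := by exact_mod_cast card_pos.2 ⟨v, h.mem⟩
    rw [hc, map_add, map_zsmul, zsmul_eq_mul]
    calc φ (b m) + c * φ (b i) ≤ C + (#A - 1) * C :=
          add_le_add (hφ m) (mul_le_mul hcard (hφ i) hφi.le (sub_nonneg.2 hA₁))
      _ = #A * C := by ring
  · obtain ⟨t, ht, hb⟩ := neighbour_eq_smul_of_repr_edge_ne_zero h h' hl hj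
    rw [hb, map_smul, smul_eq_mul]
    exact (mul_neg_of_neg_of_pos ht hφi).le.trans (by positivity)

end Neighbour

variable (hA : IsLatticeConvex L A)
  (hb : ∀ w, IsVertex A w → ∃ b : Module.Basis ι ℝ E, IsEdgeBasis L A w b)
include hA hb

theorem exists_increasing_neighbour (h : IsEdgeBasis L A v b) {φ : Module.Dual ℝ E} {C : ℝ}
    (hφ : ∀ i, φ (b i) ≤ C) {a : E} (ha : a ∈ A) (hpos : 0 < φ (a - v)) :
    ∃ (w : E) (b' : Module.Basis ι ℝ E), IsEdgeBasis L A w b' ∧ φ v < φ w ∧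
      φ (w - v) ≤ (#A - 1) * C ∧ ∀ j, φ (b' j) ≤ #A * C := by
  obtain ⟨i, hi⟩ : ∃ i, 0 < φ (b i) := by
    by_contra! hneg
    rw [apply_eq_sum_repr_mul b] at hpos
    exact hpos.not_ge (sum_nonpos fun i _ =>
      mul_nonpos_of_nonneg_of_nonpos (h.repr_nonneg a ha i) (hneg i))
  obtain ⟨l, hl, hw⟩ := h.exists_neighbour hA i
  obtain ⟨b', h'⟩ := hb _ hw
  refine ⟨_, b', h', ?_, ?_, h.apply_neighbour_le h' hA hl hφ hi⟩
  · rw [map_add, map_nsmul]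
    exact lt_add_of_pos_right _ (nsmul_pos hi hl.ne')
  · have hlcard : (l : ℝ) ≤ #A - 1 := by
      have := hA.lt_card h.mem hw.1 (h.basis_mem i) (b.ne_zero i)
      rw [le_sub_iff_add_le]
      exact_mod_cast this
    rw [add_sub_cancel_left, map_nsmul, nsmul_eq_mul]
    exact mul_le_mul hlcard (hφ i) hi.le (l.cast_nonneg.trans hlcard)

/-- Induction along a path of edges on which `φ` increases: each step multiplies the bound `C` on
the edge directions by at most `#A`. -/
theorem apply_sub_le_of_card_le (h : IsEdgeBasis L A v b) {φ : Module.Dual ℝ E} {C : ℝ}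
    (hC : 0 ≤ C) (hφ : ∀ i, φ (b i) ≤ C) {m : ℕ} (hm : #{x ∈ A | φ v < φ x} ≤ m) {a : E}
    (ha : a ∈ A) : φ (a - v) ≤ C * (#A ^ m - 1) := by
  have hA₁ : (1 : ℝ) ≤ #A := by exact_mod_cast card_pos.2 ⟨a, ha⟩
  induction m generalizing v b C with
  | zero =>
    simpa using filter_eq_empty_iff.1 (card_eq_zero.1 (Nat.le_zero.1 hm)) ha
  | succ m ih =>
    rcases le_or_gt (φ (a - v)) 0 with hle | hpos
    · exact hle.trans (mul_nonneg hC (sub_nonneg.2 (one_le_pow₀ hA₁)))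
    obtain ⟨w, b', h', hvw, hstep, hφ'⟩ := exists_increasing_neighbour hA hb h hφ ha hpos
    have hfilter : #{x ∈ A | φ w < φ x} < #{x ∈ A | φ v < φ x} :=
      card_lt_card <| (ssubset_iff_of_subset <|
        monotone_filter_right A fun x _ hx => hvw.trans hx).2
          ⟨w, mem_filter.2 ⟨h'.mem, hvw⟩, fun hmem => (mem_filter.1 hmem).2.false⟩
    have hrec := ih h' (by positivity) hφ' (by omega)
    calc φ (a - v) = φ (w - v) + φ (a - w) := by rw [← map_add, sub_add_sub_cancel']
      _ ≤ (#A - 1) * C + #A * C * (#A ^ m - 1) := add_le_add hstep hrec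
      _ = C * (#A ^ (m + 1) - 1) := by ring

theorem repr_sub_lt (h : IsEdgeBasis L A v b) {a : E} (ha : a ∈ A) (i : ι) :
    b.repr (a - v) i < (#A : ℝ) ^ #A := by
  have hcoord (j : ι) : b.coord i (b j) ≤ 1 := by
    classical
    rw [b.coord_apply, b.repr_self, Finsupp.single_apply]
    split_ifs <;> norm_num
  have := apply_sub_le_of_card_le hA hb h zero_le_one hcoord (card_filter_le _ _) ha
  rw [b.coord_apply, one_mul] at this
  linarith

theorem exists_repr_sub_eq_natCast (h : IsEdgeBasis L A v b) {a : E} (ha : a ∈ A) (i : ι) :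
    ∃ c : Fin (#A ^ #A), b.repr (a - v) i = ((c : ℕ) : ℝ) := by
  obtain ⟨c, hc⟩ := h.exists_repr_eq_intCast (sub_mem (hA.mem_lattice ha) (hA.mem_lattice h.mem)) i
  have hnonneg := h.repr_nonneg a ha i
  have hlt := repr_sub_lt hA hb h ha i
  rw [hc] at hnonneg hlt
  lift c to ℕ using by exact_mod_cast hnonneg
  exact ⟨⟨c, by exact_mod_cast hlt⟩, by exact_mod_cast hc⟩

end IsEdgeBasis

end EdgeBasis

section Duality

variable {R K W ι κ : Type*} [CommRing R] [IsDomain R] [Field K] [Algebra R K]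
  [Module.IsTorsionFree R K] [AddCommGroup W] [Module R W] [Module K W] [IsScalarTower R K W]
  [Finite κ]

open scoped Classical in
theorem mem_span_dualBasis_iff (e : Module.Basis κ K W) {φ : Module.Dual K W} :
    φ ∈ Submodule.span R (Set.range e.dualBasis) ↔
      ∀ x ∈ Submodule.span R (Set.range e), φ x ∈ (1 : Submodule R K) := by
  calc φ ∈ Submodule.span R (Set.range e.dualBasis)
      ↔ ∀ i, φ (e i) ∈ (1 : Submodule R K) := by
        simp only [e.dualBasis.mem_span_iff_repr_mem R, e.dualBasis_repr, Submodule.mem_one,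
          Set.mem_range]
    _ ↔ Submodule.span R (Set.range e) ≤ (1 : Submodule R K).comap (φ.restrictScalars R) := by
        rw [Submodule.span_le, Set.range_subset_iff]
        rfl

open scoped Classical in
theorem mem_span_iff_forall_mem_span_dualBasis (e : Module.Basis κ K W) {x : W} :
    x ∈ Submodule.span R (Set.range e) ↔
      ∀ φ ∈ Submodule.span R (Set.range e.dualBasis), φ x ∈ (1 : Submodule R K) := by
  refine ⟨fun hx φ hφ => (mem_span_dualBasis_iff e).1 hφ x hx, fun h => ?_⟩
  rw [e.mem_span_iff_repr_mem R]
  intro i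
  have hi := h (e.dualBasis i) (Submodule.subset_span ⟨i, rfl⟩)
  rwa [Submodule.mem_one, e.coe_dualBasis, e.coord_apply] at hi

theorem exists_basis_eq_coe (e : Module.Basis κ K W)
    (b : Module.Basis ι R (Submodule.span R (Set.range e))) :
    ∃ B : Module.Basis ι K W, (∀ i, B i = b i) ∧
      Submodule.span R (Set.range B) = Submodule.span R (Set.range e) := by
  have := Module.Finite.of_basis (e.restrictScalars R)
  have := Module.Finite.finite_basis b
  have := Fintype.ofFinite ι
  have := Fintype.ofFinite κ
  have hspan : Submodule.span R (Set.range fun i => (b i : W)) =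
      Submodule.span R (Set.range e) := by
    have := congrArg (Submodule.map (Submodule.subtype _)) b.span_eq
    rwa [Submodule.map_span, ← Set.range_comp, Submodule.map_subtype_top] at this
  have htop : ⊤ ≤ Submodule.span K (Set.range fun i => (b i : W)) := by
    rw [← Submodule.span_span_of_tower R K, hspan, Submodule.span_span_of_tower, e.span_eq]
  have hcard : Fintype.card ι = Module.finrank K W := by
    rw [Module.finrank_eq_card_basis e, ← Module.finrank_eq_card_basis b,
      Module.finrank_eq_card_basis (e.restrictScalars R)]
  refine ⟨basisOfTopLeSpanOfCardEqFinrank _ htop hcard, fun i => by simp, ?_⟩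
  rwa [coe_basisOfTopLeSpanOfCardEqFinrank]

theorem exists_basis_coord_eq (e : Module.Basis κ K W) {N : Submodule R (Module.Dual K W)}
    (hN : ∀ φ, φ ∈ N ↔ ∀ x ∈ Submodule.span R (Set.range e), φ x ∈ (1 : Submodule R K))
    (b : Module.Basis ι R N) :
    ∃ u : Module.Basis ι K W, (∀ i, u.coord i = b i) ∧
      Submodule.span R (Set.range u) = Submodule.span R (Set.range e) := by
  classical
  obtain rfl : N = Submodule.span R (Set.range e.dualBasis) := by
    ext φ
    rw [hN, mem_span_dualBasis_iff]
  obtain ⟨B, hB, hspan⟩ := exists_basis_eq_coe e.dualBasis b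
  have := Module.Finite.of_basis e
  have := Module.Finite.finite_basis B
  let u := B.dualBasis.map (Module.evalEquiv K W).symm
  have hu : u.dualBasis = B := Module.Basis.eq_ofRepr_eq_repr fun φ i => by
    simp [u]
  refine ⟨u, fun i => ?_, ?_⟩
  · rw [← hB, ← hu, u.coe_dualBasis]
  · ext x
    rw [mem_span_iff_forall_mem_span_dualBasis, mem_span_iff_forall_mem_span_dualBasis, hu, hspan]

end Duality

section NormalCone

variable {E ι : Type*} [AddCommGroup E] [Module ℝ E] {L : Submodule ℤ E} {A : Finset E} {v : E}
  {u : Module.Basis ι ℝ E}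

theorem IsEdgeBasis.of_forall_nonneg_iff (hA : IsLatticeConvex L A) (hv : v ∈ A)
    (hu : Submodule.span ℤ (Set.range u) = L)
    (hcone : ∀ ψ : Module.Dual ℝ E, (∀ a ∈ A, 0 ≤ ψ (a - v)) ↔ ∀ i, 0 ≤ ψ (u i)) :
    IsEdgeBasis L A v u := by
  classical
  have hrepr : ∀ a ∈ A, ∀ i, 0 ≤ u.repr (a - v) i := fun a ha i =>
    (hcone (u.coord i)).2 (fun j => by
      rw [u.coord_apply, u.repr_self, Finsupp.single_apply]
      split_ifs <;> norm_num) a ha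
  refine ⟨hu, hv, hrepr, fun i => ?_⟩
  obtain ⟨K, hK⟩ := (eventually_forall_pos_add_mul A (fun a => offEdge u i (a - v))
    fun a => -u.coord i (a - v)).exists
  obtain ⟨a, ha, hneg⟩ : ∃ a ∈ A, (-u.coord i + K • offEdge u i) (a - v) < 0 := by
    by_contra! hnonneg
    have := (hcone _).1 hnonneg i
    simp [offEdge_self, not_le.2 zero_lt_one] at this
  have hle : offEdge u i (a - v) ≤ 0 := not_lt.1 fun hpos => (hK a ha hpos).not_gt hneg
  have hedge := eq_smul_of_offEdge_nonpos (fun j _ => hrepr a ha j) hle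
  have hmem := sub_mem (hA.mem_lattice ha) (hA.mem_lattice hv)
  rw [← hu, u.mem_span_iff_repr_mem ℤ] at hmem
  obtain ⟨c, hc⟩ := hmem i
  rw [algebraMap_int_eq, eq_intCast] at hc
  rw [hedge, ← hc] at hneg
  have hc₀ : 0 < c := by simpa [offEdge_self] using hneg
  lift c to ℕ using hc₀.le
  have hac : v + c • u i = a := by
    rw [← eq_sub_iff_add_eq', hedge, ← hc, Int.cast_natCast, Nat.cast_smul_eq_nsmul]
  simpa using hA.add_nsmul_mem (m := 1) hv (hac ▸ ha)
    (hu ▸ Submodule.subset_span (Set.mem_range_self i)) (by exact_mod_cast hc₀)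

theorem mem_hull_image_coord_iff [Finite ι] {s : Set ι} {ψ : Module.Dual ℝ E} :
    ψ ∈ PointedCone.hull ℝ (u.coord '' s) ↔ ∀ i, 0 ≤ ψ (u i) ∧ (i ∉ s → ψ (u i) = 0) := by
  constructor
  · intro hψ i
    induction hψ using Submodule.span_induction with
    | mem φ hφ =>
      obtain ⟨j, hj, rfl⟩ := hφ
      rw [u.coord_apply, u.repr_self]
      rcases eq_or_ne j i with rfl | hji
      · simp [hj]
      · simp [hji]
    | zero => simp
    | add φ φ' _ _ hφ hφ' =>
      exact ⟨add_nonneg hφ.1 hφ'.1, fun hi => by simp [hφ.2 hi, hφ'.2 hi]⟩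
    | smul c φ _ hφ => exact ⟨mul_nonneg c.2 hφ.1, fun hi => mul_eq_zero_of_right _ (hφ.2 hi)⟩
  · intro h
    have := Fintype.ofFinite ι
    rw [← u.sum_dual_apply_smul_coord ψ]
    refine Submodule.sum_mem _ fun i _ => ?_
    by_cases hi : i ∈ s
    · exact PointedCone.smul_mem _ (h i).1 (PointedCone.subset_hull ⟨i, hi, rfl⟩)
    · rw [(h i).2 hi, zero_smul]
      exact zero_mem _

theorem IsVertex.isEdgeBasis_of_mem_hull_iff [Finite ι] (hA : IsLatticeConvex L A)
    (hv : IsVertex A v) (hu : Submodule.span ℤ (Set.range u) = L) {s : Set ι}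
    (hcone : ∀ ψ : Module.Dual ℝ E, (∀ a ∈ A, 0 ≤ ψ (a - v)) ↔
      ψ ∈ PointedCone.hull ℝ (u.coord '' s)) :
    IsEdgeBasis L A v u := by
  simp only [mem_hull_image_coord_iff] at hcone
  obtain ⟨hvA, φ, hφ⟩ := hv
  have hφ_pos : ∀ a ∈ A, a ≠ v → 0 < φ (a - v) := fun a ha hav => by
    rw [map_sub]
    exact sub_pos.2 (hφ a ha hav)
  have hφ_cone := (hcone φ).1 fun a ha => by
    rcases eq_or_ne a v with rfl | hav
    · simp
    · exact (hφ_pos a ha hav).le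
  have hs (j : ι) : j ∈ s := by
    by_contra hj
    obtain ⟨K, hK⟩ := (eventually_forall_pos_add_mul A (fun a => φ (a - v))
      fun a => u.coord j (a - v)).exists
    have hcoord := (hcone (u.coord j + K • φ)).1 fun a ha => by
      rcases eq_or_ne a v with rfl | hav
      · simp
      · exact (hK a ha (hφ_pos a ha hav)).le
    simpa [(hφ_cone j).2 hj] using (hcoord j).2 hj
  exact .of_forall_nonneg_iff hA hvA hu fun ψ => (hcone ψ).trans <| by simp [hs]

end NormalCone

section SpanLattice

variable {n : ℕ} {P : Set (Fin n → ℝ)} {p : Fin n → ℝ}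

theorem intLattice_eq_span (n : ℕ) :
    intLattice n = Submodule.span ℤ (Set.range (Pi.basisFun ℝ (Fin n))) := by
  ext x
  rw [Module.Basis.mem_span_iff_repr_mem ℤ (Pi.basisFun ℝ (Fin n))]
  simp only [Pi.basisFun_repr, Set.mem_range, algebraMap_int_eq, eq_intCast]
  exact forall_congr' fun i => exists_congr fun k => eq_comm

instance (n : ℕ) : DiscreteTopology (intLattice n) := by
  rw [intLattice_eq_span]
  infer_instance

theorem IsLatticePolytope.convexHull_inter_intLattice (hP : IsLatticePolytope P) :
    convexHull ℝ (P ∩ intLattice n) = P := by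
  obtain ⟨S, -, hS, rfl⟩ := hP
  exact (convexHull_min Set.inter_subset_left (convex_convexHull ℝ _)).antisymm
    (convexHull_mono fun x hx => ⟨subset_convexHull ℝ _ hx, hS x hx⟩)

theorem IsLatticePolytope.inter_intLattice_nonempty (hP : IsLatticePolytope P) :
    (P ∩ intLattice n).Nonempty := by
  obtain ⟨S, ⟨p, hp⟩, hS, rfl⟩ := hP
  exact ⟨p, subset_convexHull ℝ _ hp, hS p hp⟩

/-- The lattice `M` of the points of `ℤⁿ` in the linear space parallel to the affine span of `P`,
whose dual is `dualLattice P`. -/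
noncomputable def spanLattice (P : Set (Fin n → ℝ)) : Submodule ℤ (vectorSpan ℝ P) :=
  ZLattice.comap ℝ (intLattice n) (vectorSpan ℝ P).subtype

theorem mem_spanLattice {x : vectorSpan ℝ P} :
    x ∈ spanLattice P ↔ (x : Fin n → ℝ) ∈ intLattice n :=
  Iff.rfl

instance (P : Set (Fin n → ℝ)) : DiscreteTopology (spanLattice P) :=
  ZLattice.comap_discreteTopology ℝ _ continuous_subtype_val Subtype.val_injective

theorem IsLatticePolytope.span_spanLattice (hP : IsLatticePolytope P) :
    Submodule.span ℝ (spanLattice P : Set (vectorSpan ℝ P)) = ⊤ := by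
  suffices h : vectorSpan ℝ P ≤
      (Submodule.span ℝ (spanLattice P : Set (vectorSpan ℝ P))).map (vectorSpan ℝ P).subtype by
    rw [eq_top_iff]
    rintro x -
    obtain ⟨y, hy, hyx⟩ := h x.2
    rwa [← Subtype.ext hyx]
  have hspan : vectorSpan ℝ P = vectorSpan ℝ (P ∩ intLattice n) := by
    conv_lhs => rw [← hP.convexHull_inter_intLattice]
    rw [← direction_affineSpan, affineSpan_convexHull, direction_affineSpan]
  refine hspan.le.trans (Submodule.span_le.2 ?_)
  rintro _ ⟨x, hx, y, hy, rfl⟩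
  exact ⟨⟨x - y, vsub_mem_vectorSpan ℝ hx.1 hy.1⟩,
    Submodule.subset_span (sub_mem (S := Submodule ℤ _) hx.2 hy.2), rfl⟩

theorem IsLatticePolytope.exists_basis_span_eq (hP : IsLatticePolytope P) :
    ∃ (m : ℕ) (e : Module.Basis (Fin m) ℝ (vectorSpan ℝ P)),
      Submodule.span ℤ (Set.range e) = spanLattice P := by
  have : IsZLattice ℝ (spanLattice P) := ⟨hP.span_spanLattice⟩
  have := ZLattice.module_finite ℝ (spanLattice P)
  have := ZLattice.module_free ℝ (spanLattice P)
  exact ⟨_, (Module.finBasis ℤ (spanLattice P)).ofZLatticeBasis ℝ _,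
    Module.Basis.ofZLatticeBasis_span ..⟩

/-- The parametrization `x ↦ x + p` of the affine span of `P` by its direction, for a base point
`p` of `P`. -/
noncomputable def spanParam (P : Set (Fin n → ℝ)) (p : Fin n → ℝ) :
    vectorSpan ℝ P →ᵃ[ℝ] (Fin n → ℝ) :=
  (vectorSpan ℝ P).subtype.toAffineMap + AffineMap.const ℝ _ p

theorem spanParam_apply (x : vectorSpan ℝ P) : spanParam P p x = x + p :=
  rfl

theorem spanParam_injective : Function.Injective (spanParam P p) :=
  (add_left_injective p).comp Subtype.val_injective

theorem spanParam_mem_intLattice_iff (hp : p ∈ intLattice n) {x : vectorSpan ℝ P} :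
    spanParam P p x ∈ intLattice n ↔ x ∈ spanLattice P := by
  rw [spanParam_apply, mem_spanLattice, Submodule.add_mem_iff_left _ hp]

theorem subset_range_spanParam (hp : p ∈ P) : P ⊆ Set.range (spanParam P p) := fun x hx =>
  ⟨⟨x - p, vsub_mem_vectorSpan ℝ hx hp⟩, sub_add_cancel x p⟩

theorem IsLatticePolytope.exists_isLatticeConvex (hP : IsLatticePolytope P)
    (hp : p ∈ P ∩ intLattice n) {k : ℕ} (hk : {x | x ∈ P ∧ x ∈ intLattice n}.encard = k) :
    ∃ A : Finset (vectorSpan ℝ P), #A = k ∧ IsLatticeConvex (spanLattice P) A ∧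
      spanParam P p '' convexHull ℝ (A : Set (vectorSpan ℝ P)) = P := by
  set τ := spanParam P p
  have hτ : Function.Injective τ := spanParam_injective
  have hfin : (P ∩ intLattice n).Finite := Set.finite_of_encard_eq_coe hk
  obtain ⟨A, hA⟩ := (hfin.preimage hτ.injOn).exists_finset_coe
  have himage : τ '' A = P ∩ intLattice n := by
    rw [hA]
    exact Set.image_preimage_eq_of_subset
      (Set.inter_subset_left.trans (subset_range_spanParam hp.1))
  have hhull : τ '' convexHull ℝ (A : Set (vectorSpan ℝ P)) = P := by
    rw [AffineMap.image_convexHull, himage, hP.convexHull_inter_intLattice]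
  refine ⟨A, ?_, fun x => ?_, hhull⟩
  · rw [← ENat.natCast_inj, ← Set.encard_coe_eq_coe_finsetCard, ← hτ.encard_image, himage]
    exact hk
  · calc x ∈ A ↔ τ x ∈ P ∧ τ x ∈ intLattice n := by
          rw [← mem_coe, hA]
          rfl
      _ ↔ x ∈ convexHull ℝ (A : Set (vectorSpan ℝ P)) ∧ x ∈ spanLattice P := by
          rw [spanParam_mem_intLattice_iff hp.2, ← hτ.mem_set_image, hhull]

theorem mem_normalCone_singleton_iff {A : Finset (vectorSpan ℝ P)}
    (hA : spanParam P p '' convexHull ℝ (A : Set (vectorSpan ℝ P)) = P) {v : vectorSpan ℝ P}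
    {φ : Module.Dual ℝ (vectorSpan ℝ P)} :
    φ ∈ normalCone P {spanParam P p v} ↔ ∀ a ∈ A, 0 ≤ φ (a - v) := by
  have hdiff (x : vectorSpan ℝ P) :
      ((x - v : vectorSpan ℝ P) : Fin n → ℝ) = spanParam P p x - spanParam P p v := by
    simp [spanParam_apply]
  rw [normalCone, tangentCone, PointedCone.dual_hull, PointedCone.mem_dual]
  constructor
  · intro h a ha
    exact h ⟨_, rfl, _, hA.subset (Set.mem_image_of_mem _ (subset_convexHull ℝ _ ha)), hdiff a⟩
  · rintro h x ⟨_, rfl, y, hy, hxy⟩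
    rw [← hA] at hy
    obtain ⟨z, hz, rfl⟩ := hy
    obtain rfl : x = z - v := Subtype.ext (hxy.trans (hdiff z).symm)
    have hz : φ v ≤ φ z := convexHull_min (fun a ha => by simpa using h a ha)
      (convex_halfSpace_ge φ.isLinear (φ v)) hz
    simpa using hz

theorem IsVertex.isExposed_spanParam {A : Finset (vectorSpan ℝ P)}
    (hA : spanParam P p '' convexHull ℝ (A : Set (vectorSpan ℝ P)) = P) {v : vectorSpan ℝ P}
    (hv : IsVertex A v) : IsExposed ℝ P {spanParam P p v} := by
  obtain ⟨φ, hφ⟩ := hv.exists_forall_mem_convexHull_lt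
  obtain ⟨ψ, hψ⟩ := φ.exists_extend
  have hψ_apply (x : vectorSpan ℝ P) : ψ (spanParam P p x) = φ x + ψ p := by
    rw [spanParam_apply, map_add, ← hψ]
    rfl
  rw [← mem_exposedPoints_iff_exposed_singleton]
  refine ⟨hA.subset (Set.mem_image_of_mem _ (subset_convexHull ℝ _ hv.1)),
    LinearMap.toContinuousLinearMap (-ψ), fun y hy => ?_⟩
  rw [← hA] at hy
  obtain ⟨x, hx, rfl⟩ := hy
  rcases eq_or_ne x v with rfl | hxv
  · simp
  · have hlt : ψ (spanParam P p v) < ψ (spanParam P p x) := by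
      simpa only [hψ_apply, add_lt_add_iff_right] using hφ x hx hxv
    exact ⟨neg_le_neg hlt.le, fun hle => absurd (neg_le_neg_iff.1 hle) hlt.not_ge⟩

theorem IsVertex.exists_isEdgeBasis (hP : IsLatticePolytope P) (hsmooth : IsSmooth P)
    {A : Finset (vectorSpan ℝ P)} (hA : IsLatticeConvex (spanLattice P) A)
    (hAP : spanParam P p '' convexHull ℝ (A : Set (vectorSpan ℝ P)) = P) {v : vectorSpan ℝ P}
    (hv : IsVertex A v) :
    ∃ b : Module.Basis (Fin (Module.finrank ℝ (vectorSpan ℝ P))) ℝ (vectorSpan ℝ P),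
      IsEdgeBasis (spanLattice P) A v b := by
  obtain ⟨_, e, he⟩ := hP.exists_basis_span_eq
  obtain ⟨m, b, s, hs⟩ := hsmooth _
    ⟨_, Set.singleton_nonempty _, hv.isExposed_spanParam hAP, rfl⟩
  obtain ⟨u, hu, hspan⟩ := exists_basis_coord_eq e (N := dualLattice P) (fun φ => by
    rw [he]
    simp only [Submodule.mem_one, algebraMap_int_eq, eq_intCast, @eq_comm ℝ (Int.cast _)]
    rfl) b
  obtain rfl : Module.finrank ℝ (vectorSpan ℝ P) = m := by
    rw [Module.finrank_eq_card_basis u, Fintype.card_fin]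
  refine ⟨u, hv.isEdgeBasis_of_mem_hull_iff hA (hspan.trans he) (s := s) fun ψ => ?_⟩
  rw [← mem_normalCone_singleton_iff hAP, hs, funext hu]

end SpanLattice

section EdgeParam

variable {E ι : Type*} [AddCommGroup E] [Module ℝ E] {d : ℕ} {L : Submodule ℤ E} {A : Finset E}
  {v : E} {b : Module.Basis (Fin d) ℝ E}

/-- The point of `ℝᵈ` with coordinates `c`; these are the lattice points of the box
`[0, N - 1]ᵈ`. -/
def boxPoint {N : ℕ} (c : Fin d → Fin N) : Fin d → ℝ :=
  fun i => ((c i : ℕ) : ℝ)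

/-- The affine coordinate system with origin `v` and axes `b`, as a parametrization of `E`. When
`b` is the edge basis at `v`, it puts the vertex `v` and the edges at `v` in standard position. -/
noncomputable def edgeParam [Fintype ι] (b : Module.Basis ι ℝ E) (v : E) : (ι → ℝ) ≃ᵃ[ℝ] E :=
  b.equivFun.symm.toAffineEquiv.trans (AffineEquiv.constVAdd ℝ E v)

theorem edgeParam_apply [Fintype ι] (b : Module.Basis ι ℝ E) (v : E) (y : ι → ℝ) :
    edgeParam b v y = v + b.equivFun.symm y :=
  rfl

theorem edgeParam_mem_iff (hv : v ∈ L) (hb : Submodule.span ℤ (Set.range b) = L)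
    {y : Fin d → ℝ} : edgeParam b v y ∈ L ↔ y ∈ intLattice d := by
  rw [edgeParam_apply, Submodule.add_mem_iff_right _ hv, ← hb, b.mem_span_iff_repr_mem ℤ]
  refine forall_congr' fun i => exists_congr fun c => ?_
  rw [← b.equivFun_apply, LinearEquiv.apply_symm_apply, eq_comm, algebraMap_int_eq, eq_intCast]

theorem IsEdgeBasis.exists_edgeParam_image_boxPoint_eq (hA : IsLatticeConvex L A)
    (hb : ∀ w, IsVertex A w → ∃ b : Module.Basis (Fin d) ℝ E, IsEdgeBasis L A w b)
    (h : IsEdgeBasis L A v b) :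
    ∃ S : Set (Fin d → Fin (#A ^ #A)), edgeParam b v '' (boxPoint '' S) = A := by
  refine ⟨(edgeParam b v ∘ boxPoint) ⁻¹' A, ?_⟩
  rw [← Set.image_comp, Set.image_preimage_eq_of_subset]
  intro a ha
  choose c hc using fun i => exists_repr_sub_eq_natCast hA hb h ha i
  have hrepr : boxPoint c = b.equivFun (a - v) := funext fun i => (hc i).symm
  refine ⟨c, ?_⟩
  rw [Function.comp_apply, edgeParam_apply, hrepr, LinearEquiv.symm_apply_apply, add_sub_cancel]

end EdgeParam

section FiniteClasses

theorem integrallyEquivalent_image {m n : ℕ} {f : (Fin m → ℝ) →ᵃ[ℝ] (Fin n → ℝ)}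
    (hf : Function.Injective f) (hf' : ∀ y, f y ∈ intLattice n ↔ y ∈ intLattice m)
    (Q : Set (Fin m → ℝ)) : IntegrallyEquivalent Q (f '' Q) := by
  refine ⟨f, ⟨fun y hy => ⟨(hf' y).2 hy.1, ?_⟩, hf.injOn, ?_⟩, rfl⟩
  · rw [← AffineSubspace.map_span]
    exact AffineSubspace.mem_map_of_mem f hy.2
  · rintro _ ⟨hx, hx'⟩
    rw [← AffineSubspace.map_span] at hx'
    obtain ⟨y, hy, rfl⟩ := hx'
    exact ⟨y, ⟨(hf' y).1 hx, hy⟩, rfl⟩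

theorem integrallyEquivalent_image_symm {m n : ℕ} {f : (Fin m → ℝ) →ᵃ[ℝ] (Fin n → ℝ)}
    (hf : Function.Injective f) (hf' : ∀ y, f y ∈ intLattice n ↔ y ∈ intLattice m)
    {Q : Set (Fin m → ℝ)} (hQ : Q.Nonempty) : IntegrallyEquivalent (f '' Q) Q := by
  refine (integrallyEquivalent_image hf hf' Q).symm hQ ?_
  rw [← AffineMap.map_vectorSpan]
  exact (Submodule.equivMapOfInjective _ ((AffineMap.linear_injective_iff f).2 hf) _).finrank_eq

theorem IsSmooth.exists_integrallyEquivalent_boxPoint {n k : ℕ} {P : Set (Fin n → ℝ)}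
    (hsmooth : IsSmooth P) (hP : IsLatticePolytope P)
    (hk : {x | x ∈ P ∧ x ∈ intLattice n}.encard = k) :
    ∃ S : Set (Fin (Module.finrank ℝ (vectorSpan ℝ P)) → Fin (k ^ k)),
      IntegrallyEquivalent P (convexHull ℝ (boxPoint '' S)) ∧
      IntegrallyEquivalent (convexHull ℝ (boxPoint '' S)) P := by
  obtain ⟨p, hp⟩ := hP.inter_intLattice_nonempty
  obtain ⟨A, rfl, hA, hAP⟩ := hP.exists_isLatticeConvex hp hk
  have hb := fun w (hw : IsVertex A w) => hw.exists_isEdgeBasis hP hsmooth hA hAP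
  have hne : (spanParam P p '' convexHull ℝ (A : Set (vectorSpan ℝ P))).Nonempty :=
    ⟨p, hAP.symm ▸ hp.1⟩
  obtain ⟨v, hv⟩ := exists_isVertex (convexHull_nonempty_iff.1 hne.of_image)
  obtain ⟨b, h⟩ := hb v hv
  obtain ⟨S, hS⟩ := h.exists_edgeParam_image_boxPoint_eq hA hb
  set Q := convexHull ℝ (boxPoint '' S)
  let f := (spanParam P p).comp (edgeParam b v).toAffineMap
  have hf : Function.Injective f := spanParam_injective.comp (edgeParam b v).injective
  have hf' (y) : f y ∈ intLattice n ↔ y ∈ intLattice _ :=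
    (spanParam_mem_intLattice_iff hp.2).trans
      (edgeParam_mem_iff (hA.mem_lattice h.mem) h.span_range)
  have himage : f '' Q = P := by
    rw [AffineMap.coe_comp, Set.image_comp, AffineMap.image_convexHull]
    exact (congrArg (fun B => spanParam P p '' convexHull ℝ B) hS).trans hAP
  have hQ : Q.Nonempty := Set.Nonempty.of_image (f := f) (himage.symm ▸ ⟨p, hp.1⟩)
  have hQP := integrallyEquivalent_image hf hf' Q
  have hPQ := integrallyEquivalent_image_symm hf hf' hQ
  rw [himage] at hQP hPQ
  exact ⟨S, hPQ, hQP⟩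

end FiniteClasses

end SmoothPolytope

theorem mainTheorem3 (d k : ℕ) :
    Finite (Quotient (SmoothPolytope.integralEquivalence d k)) := by
  have hbox (P : SmoothPolytope.SmoothLatticePolytope d k) :
      ∃ S : Set (Fin d → Fin (k ^ k)),
        SmoothPolytope.IntegrallyEquivalent P.carrier
          (convexHull ℝ (SmoothPolytope.boxPoint '' S)) ∧
        SmoothPolytope.IntegrallyEquivalent (convexHull ℝ (SmoothPolytope.boxPoint '' S))
          P.carrier := by
    obtain ⟨n, P, hP, rfl, hsmooth, hk⟩ := P
    exact hsmooth.exists_integrallyEquivalent_boxPoint hP hk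
  choose S hS hS' using hbox
  refine Finite.of_injective (fun q : Quotient _ => S q.out) ?_
  intro q q' (heq : S q.out = S q'.out)
  rw [← q.out_eq, ← q'.out_eq]
  exact Quotient.sound ((hS q.out).trans (heq ▸ hS' q'.out))
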